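/- Fix a set $Var$ of variables and a vocabulary of predicate symbols $P$ with arities. A \emph{topo-dependence model} consists of a $T_0$ topological space $(\mathbb D_x,\tau_x)$ for every $x\in Var$, a set $S$ of states, a surjection $\mathbf x:S\to\mathbb D_x$ for every $x\in Var$, and an interpretation $I(P)$ of each $n$-ary $P$ as an $n$-ary relation on $\bigcup_x\mathbb D_x$. It is a \emph{metric} dependence model if every $\tau_x$ is given by a metric. For a finite $X\subseteq Var$ let $\mathbf X(s)=(\mathbf x(s))_{x\in X}$, let $\mathbb D_X=\mathbf X(S)\subseteq\prod_{x\in X}\mathbb D_x$ carry the subspace topology $\tau_X$ of the product topology, and let $\tau_X^S=\{\mathbf X^{-1}(U):U\in\tau_X\}$ be the $X$-topology on $S$. The formulas of $\mathsf{LCD}$ are, with $X,Y$ ranging over finite subsets of $Var$ and $\vec x$ over tuples of variables of the right length, $$\varphi::=P\vec x\mid\neg\varphi\mid\varphi\wedge\varphi\mid D_X\varphi\mid K_X\varphi\mid D_XY\mid K_XY .$$ The language $\mathsf{LKk}$ is obtained by replacing the atoms $K_XY$ of $\mathsf{LCD}$ by atoms $k_XY$. Predicate atoms and Boolean connectives are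 interpreted as usual, and at a state $s$: \begin{itemize} \item $s\models D_X\varphi$ iff $t\models\varphi$ for all $t\in S$ with $\mathbf X(t)=\mathbf X(s)$; \item $s\models K_X\varphi$ iff $s$ is in the interior of $\{t:t\models\varphi\}$ in the $X$-topology; \item $s\models D_XY$ iff $\mathbf Y(t)=\mathbf Y(s)$ for all $t\in S$ with $\mathbf X(t)=\mathbf X(s)$; \item $s\models K_XY$ iff there are $O\in\tau_X^S$ with $s\in O$ and a continuous $F:\mathbf X(O)\to\mathbb D_Y$ such that $F\circ\mathbf X=\mathbf Y$ on $O$; \item $s\models k_XY$ (conditional knowability) iff for every open $U\ni\mathbf Y(s)$ in $\mathbb D_Y$ there is an open $V\ni\mathbf X(s)$ in $\mathbb D_X$ with $\mathbf X^{-1}(V)\subseteq\mathbf Y^{-1}(U)$. \end{itemize} Two formulas are \emph{equivalent} over a class of models if they are true at the same states of all models in the class. $\mathsf{LKk}$ is \emph{more expressive} than $\mathsf{LCD}$ over a class if every $\mathsf{LCD}$ formula is equivalent over the class to an $\mathsf{LKk}$ formula, while some $\mathsf{LKk}$ formula is not equivalent over it to any $\mathsf{LCD}$ formula. \textbf{Proposition.}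 Conditional knowability $k_XY$ is not expressible in $\mathsf{LCD}$: \begin{enumerate} \item for all finite $X,Y\subseteq Var$ with $Y\not\subseteq X$, no $\mathsf{LCD}$ formula is equivalent to $k_XY$ over all topo-dependence models; \item if moreover $X\neq\emptyset$, no $\mathsf{LCD}$ formula is equivalent to $k_XY$ even over the metric dependence models only. \end{enumerate} Consequently $\mathsf{LKk}$ is more expressive than $\mathsf{LCD}$: over all topo-dependence models provided that $Var\neq\emptyset$, and over the metric dependence models provided that $Var$ has at least two elements. -/

import Mathlib

universe u v w

namespace DepLogic

/-- A topo-dependence model over a set `Var` of basic variables and a relational vocabulary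
with arity map `ar`: a `T₀` topological space `D x` of values for each variable `x`, an
interpretation `I` of every predicate symbol as a relation on the union of the value ranges
(each variable has its own type, so the union is a tagged one), a set `State` of abstract
states, and for each `x` an empirical variable, i.e. a surjective map `val x : State → D x`. -/
structure TopoDepModel {Var : Type u} {Pred : Type v} (ar : Pred → ℕ) where
  D : Var → Type w
  top : ∀ x, TopologicalSpace (D x)
  t0 : ∀ x, T0Space (D x)
  I : ∀ P : Pred, Set (Fin (ar P) → Σ x, D x)
  State : Type w
  val : ∀ x, State → D x
  surj : ∀ x, Function.Surjective (val x)

attribute [instance] TopoDepModel.top TopoDepModel.t0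

namespace TopoDepModel

variable {Var : Type u} {Pred : Type v} {ar : Pred → ℕ} (M : TopoDepModel.{u, v, w} (Var := Var) ar)

/-- The range `𝔻_X ⊆ ∏_{x ∈ X} 𝔻_x` of the joint variable `X`; as a subtype of a product it
carries the subspace topology of the product topology. -/
abbrev Range (X : Finset Var) : Type (max u w) :=
  Set.range (fun (s : M.State) (x : X) => M.val x s)

/-- The joint empirical variable `𝐗 : S → 𝔻_X` of a finite set `X` of variables. -/
def joint (X : Finset Var) : M.State → M.Range X :=
  Set.rangeFactorization (fun (s : M.State) (x : X) => M.val x s)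

/-- The `X`-topology on states: its opens are the preimages `𝐗⁻¹(U)` of opens `U` of `𝔻_X`. -/
abbrev stateTop (X : Finset Var) : TopologicalSpace M.State :=
  TopologicalSpace.induced (M.joint X) inferInstance

/-- Truth of the atom `P x₁ … xₙ` at `s`. -/
def HoldsAtom (s : M.State) (P : Pred) (xs : Fin (ar P) → Var) : Prop :=
  (fun i => (⟨xs i, M.val (xs i) s⟩ : Σ x, M.D x)) ∈ M.I P

/-- `s ⊨ D_X Q`: exact determination of a proposition. -/
def Determines (s : M.State) (X : Finset Var) (Q : Set M.State) : Prop :=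
  ∀ t, M.joint X s = M.joint X t → t ∈ Q

/-- `s ⊨ K_X Q`: `s` lies in the interior of `Q` in the `X`-topology. -/
def Knowable (s : M.State) (X : Finset Var) (Q : Set M.State) : Prop :=
  s ∈ @interior M.State (M.stateTop X) Q

/-- `s ⊨ D_X Y`: exact dependence. -/
def ExactDep (s : M.State) (X Y : Finset Var) : Prop :=
  ∀ t, M.joint X s = M.joint X t → M.joint Y s = M.joint Y t

/-- `s ⊨ K_X Y`: on some `X`-open neighbourhood `O` of `s`, `𝐘 = F ∘ 𝐗` for a continuous
`F : 𝐗(O) → 𝔻_Y`. -/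
def EpistemicDep (s : M.State) (X Y : Finset Var) : Prop :=
  ∃ O : Set M.State, @IsOpen M.State (M.stateTop X) O ∧ s ∈ O ∧
    ∃ F : (M.joint X '' O) → M.Range Y, Continuous F ∧
      ∀ (t : M.State) (ht : t ∈ O), F ⟨M.joint X t, Set.mem_image_of_mem _ ht⟩ = M.joint Y t

/-- `s ⊨ k_X Y`: conditional knowability of `Y` given `X` (continuity at a point). -/
def CondKnowable (s : M.State) (X Y : Finset Var) : Prop :=
  ∀ U : Set (M.Range Y), IsOpen U → M.joint Y s ∈ U →
    ∃ V : Set (M.Range X), IsOpen V ∧ M.joint X s ∈ V ∧ M.joint X ⁻¹' V ⊆ M.joint Y ⁻¹' U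

/-- `M` is a metric dependence model: each of its topologies is given by a metric. -/
def IsMetric : Prop := ∀ x, TopologicalSpace.MetrizableSpace (M.D x)

end TopoDepModel

/-- Formulas of the logic of continuous dependence `LCD`:
`P x⃗ | ¬φ | φ ∧ φ | D_X φ | K_X φ | D_X Y | K_X Y`. -/
inductive LCD {Var : Type u} {Pred : Type v} (ar : Pred → ℕ) : Type (max u v)
  | atom (P : Pred) (xs : Fin (ar P) → Var) : LCD ar
  | neg (φ : LCD (Var := Var) ar) : LCD ar
  | and (φ ψ : LCD (Var := Var) ar) : LCD ar
  | det (X : Finset Var) (φ : LCD (Var := Var) ar) : LCD ar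
  | know (X : Finset Var) (φ : LCD (Var := Var) ar) : LCD ar
  | exactDep (X Y : Finset Var) : LCD ar
  | epistemicDep (X Y : Finset Var) : LCD ar

/-- Formulas of `LKk`: those of `LCD` with the atoms `K_X Y` replaced by the atoms `k_X Y`. -/
inductive LKk {Var : Type u} {Pred : Type v} (ar : Pred → ℕ) : Type (max u v)
  | atom (P : Pred) (xs : Fin (ar P) → Var) : LKk ar
  | neg (φ : LKk (Var := Var) ar) : LKk ar
  | and (φ ψ : LKk (Var := Var) ar) : LKk ar
  | det (X : Finset Var) (φ : LKk (Var := Var) ar) : LKk ar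
  | know (X : Finset Var) (φ : LKk (Var := Var) ar) : LKk ar
  | exactDep (X Y : Finset Var) : LKk ar
  | condKnow (X Y : Finset Var) : LKk ar

variable {Var : Type u} {Pred : Type v} {ar : Pred → ℕ}

/-- Truth of an `LCD` formula at a state of a topo-dependence model. -/
def LCD.Sat (M : TopoDepModel.{u, v, w} (Var := Var) ar) : LCD (Var := Var) ar → M.State → Prop
  | .atom P xs, s => M.HoldsAtom s P xs
  | .neg φ, s => ¬ φ.Sat M s
  | .and φ ψ, s => φ.Sat M s ∧ ψ.Sat M s
  | .det X φ, s => M.Determines s X {t | φ.Sat M t}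
  | .know X φ, s => M.Knowable s X {t | φ.Sat M t}
  | .exactDep X Y, s => M.ExactDep s X Y
  | .epistemicDep X Y, s => M.EpistemicDep s X Y

/-- Truth of an `LKk` formula at a state of a topo-dependence model. -/
def LKk.Sat (M : TopoDepModel.{u, v, w} (Var := Var) ar) : LKk (Var := Var) ar → M.State → Prop
  | .atom P xs, s => M.HoldsAtom s P xs
  | .neg φ, s => ¬ φ.Sat M s
  | .and φ ψ, s => φ.Sat M s ∧ ψ.Sat M s
  | .det X φ, s => M.Determines s X {t | φ.Sat M t}
  | .know X φ, s => M.Knowable s X {t | φ.Sat M t}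
  | .exactDep X Y, s => M.ExactDep s X Y
  | .condKnow X Y, s => M.CondKnowable s X Y

/-- `φ` and `ψ` are true at the same states of all models in the class `C`. -/
def EquivalentOver (C : Set (TopoDepModel.{u, v, w} (Var := Var) ar))
    (φ : LCD (Var := Var) ar) (ψ : LKk (Var := Var) ar) : Prop :=
  ∀ M ∈ C, ∀ s : M.State, φ.Sat M s ↔ ψ.Sat M s

/-- Some `LCD` formula is equivalent to the `LKk` formula `ψ` over the class `C`. -/
def ExpressibleInLCD (C : Set (TopoDepModel.{u, v, w} (Var := Var) ar))
    (ψ : LKk (Var := Var) ar) : Prop :=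
  ∃ φ : LCD (Var := Var) ar, EquivalentOver C φ ψ

/-- Over the class `C`, `LKk` is strictly more expressive than `LCD`: every `LCD` formula is
equivalent to an `LKk` formula, but not conversely. -/
def LKkStrictlyMoreExpressive (C : Set (TopoDepModel.{u, v, w} (Var := Var) ar)) : Prop :=
  (∀ φ : LCD (Var := Var) ar, ∃ ψ : LKk (Var := Var) ar, EquivalentOver C φ ψ) ∧
    ∃ ψ : LKk (Var := Var) ar, ¬ ExpressibleInLCD C ψ

/-- The class of all topo-dependence models. -/
def topoModels (ar : Pred → ℕ) : Set (TopoDepModel.{u, v, w} (Var := Var) ar) := Set.univ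

/-- The class of metric dependence models. -/
def metricModels (ar : Pred → ℕ) : Set (TopoDepModel.{u, v, w} (Var := Var) ar) :=
  {M | M.IsMetric}

end DepLogic

/-!
A formula of `LCD` cannot tell apart two states of a model all of whose states agree on every atom
`P x⃗`, `D_A B` and `K_A B`, so it suffices to find such a model in which `k_X Y` holds at some
states and fails at others. In both models used here all variables are permutations of one space,
with at most two permutations `p` occurring among them. Then `D_A B` and `K_A B` are trivially
uniform, except for `K_A B` when all variables in `A` are equal to some `p` and some variable `y`
in `B` is not; this one fails everywhere if `y ∘ p⁻¹` is not continuous on any nonempty open set,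
whereas `k_A B` only asks for continuity at a point.

For `X ≠ ∅` the space is the real line, the variables in `X` are the identity, and the others
reflect the irrationals and fix the rationals, which is continuous precisely at `0`. For `X = ∅`
all variables are the identity of the Sierpiński space, and `k_∅ Y` holds precisely at the point
whose only neighbourhood is the whole space.

In the other direction, `K_X Y` means that `k_X Y` holds on an `X`-neighbourhood of the state, so
that `K_X Y` is equivalent to `K_X k_X Y`.
-/

namespace DepLogic

open Topology Filter Set

section Topology

variable {α β γ : Type*} [TopologicalSpace α] [TopologicalSpace β] [TopologicalSpace γ]

theorem exists_continuous_comp_eq_of_isInducing [T0Space γ] {f : α → β} {g : α → γ}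
    (hf : IsInducing f) (hsurj : Function.Surjective f) (hg : Continuous g) :
    ∃ F : β → γ, Continuous F ∧ F ∘ f = g := by
  have hcomp : (g ∘ Function.surjInv hsurj) ∘ f = g := funext fun a =>
    have hfib : f (Function.surjInv hsurj (f a)) = f a := Function.surjInv_eq hsurj (f a)
    ((hf.inseparable_iff.1 (.of_eq hfib)).map hg).eq
  exact ⟨g ∘ Function.surjInv hsurj,
    (hf.isQuotientMap_of_surjective hsurj).continuous_iff.2 (hcomp.symm ▸ hg), hcomp⟩

theorem continuousAt_piecewise_iff_of_dense [T2Space β] {D : Set α} [∀ a, Decidable (a ∈ D)]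
    (hD : Dense D) (hDc : Dense Dᶜ) {f g : α → β} {a : α} (hf : ContinuousAt f a)
    (hg : ContinuousAt g a) :
    ContinuousAt (D.piecewise f g) a ↔ f a = g a := by
  constructor
  · intro h
    have hfa : D.piecewise f g a = f a := tendsto_nhds_unique_of_frequently_eq h hf <|
      (mem_closure_iff_frequently.1 (hD a)).mono fun _ => piecewise_eq_of_mem D f g
    have hga : D.piecewise f g a = g a := tendsto_nhds_unique_of_frequently_eq h hg <|
      (mem_closure_iff_frequently.1 (hDc a)).mono fun _ => piecewise_eq_of_notMem D f g
    exact hfa.symm.trans hga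
  · intro h
    have hfa : D.piecewise f g a = f a := by
      by_cases ha : a ∈ D
      · exact piecewise_eq_of_mem D f g ha
      · exact (piecewise_eq_of_notMem D f g ha).trans h.symm
    rw [ContinuousAt, hfa]
    exact (hf.mono_left inf_le_left).piecewise ((h ▸ hg.tendsto).mono_left inf_le_left)

end Topology

namespace TopoDepModel

variable {Var : Type u} {Pred : Type v} {ar : Pred → ℕ}
  (M : TopoDepModel.{u, v, w} (Var := Var) ar)

/-- The filter of neighbourhoods of the state `s` in the `X`-topology. -/
def stateNhds (X : Finset Var) (s : M.State) : Filter M.State :=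
  @nhds M.State (M.stateTop X) s

variable {M} {X Y : Finset Var} {s t : M.State}

theorem joint_eq_iff : M.joint X s = M.joint X t ↔ ∀ x ∈ X, M.val x s = M.val x t := by
  simp [joint, rangeFactorization, funext_iff]

theorem stateNhds_eq_comap_joint :
    M.stateNhds X s = comap (M.joint X) (𝓝 (M.joint X s)) :=
  nhds_induced _ _

theorem stateNhds_eq_iInf :
    M.stateNhds X s = ⨅ x ∈ X, comap (M.val x) (𝓝 (M.val x s)) := by
  rw [stateNhds_eq_comap_joint, nhds_subtype, nhds_pi, Filter.pi, comap_comap, comap_iInf,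
    iInf_subtype']
  exact iInf_congr fun _ => comap_comap

theorem stateNhds_empty : M.stateNhds ∅ s = ⊤ := by
  simp [stateNhds_eq_iInf]

theorem knowable_iff_eventually {Q : Set M.State} :
    M.Knowable s X Q ↔ ∀ᶠ t in M.stateNhds X s, t ∈ Q :=
  @mem_interior_iff_mem_nhds _ (M.stateTop X) _ _

theorem condKnowable_iff_tendsto_joint :
    M.CondKnowable s X Y ↔ Tendsto (M.joint Y) (M.stateNhds X s) (𝓝 (M.joint Y s)) := by
  rw [stateNhds_eq_comap_joint,
    ((nhds_basis_opens _).comap (M.joint X)).tendsto_iff (nhds_basis_opens _)]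
  simp only [CondKnowable, and_imp, and_assoc, and_left_comm, forall_comm (α := _ ∈ _),
    subset_def, mem_preimage]

theorem condKnowable_iff_stateNhds_le :
    M.CondKnowable s X Y ↔ M.stateNhds X s ≤ M.stateNhds Y s := by
  rw [condKnowable_iff_tendsto_joint, stateNhds_eq_comap_joint (X := Y), ← tendsto_iff_comap]

theorem condKnowable_iff_forall_tendsto :
    M.CondKnowable s X Y ↔ ∀ y ∈ Y, Tendsto (M.val y) (M.stateNhds X s) (𝓝 (M.val y s)) := by
  simp only [condKnowable_iff_stateNhds_le, stateNhds_eq_iInf (X := Y), le_iInf_iff,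
    tendsto_iff_comap]

theorem epistemicDep_iff_continuousOn :
    M.EpistemicDep s X Y ↔ ∃ O : Set M.State, IsOpen[M.stateTop X] O ∧ s ∈ O ∧
      @ContinuousOn _ _ (M.stateTop X) _ (M.joint Y) O := by
  let _ := M.stateTop X
  refine exists_congr fun O => and_congr_right fun _ => and_congr_right fun _ => ?_
  have hind : IsInducing (O.imageFactorization (M.joint X)) :=
    ((IsInducing.induced (M.joint X)).comp .subtypeVal).codRestrict _
  rw [continuousOn_iff_continuous_domRestrict]
  constructor
  · rintro ⟨F, hF, hFO⟩
    exact (hF.comp hind.continuous).congr fun t => hFO t t.2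
  · intro h
    obtain ⟨F, hF, hFO⟩ :=
      exists_continuous_comp_eq_of_isInducing hind imageFactorization_surjective h
    exact ⟨F, hF, fun t ht => congrFun hFO ⟨t, ht⟩⟩

theorem epistemicDep_iff_eventually_condKnowable :
    M.EpistemicDep s X Y ↔ ∀ᶠ t in M.stateNhds X s, M.CondKnowable t X Y := by
  let _ := M.stateTop X
  simp only [epistemicDep_iff_continuousOn, condKnowable_iff_tendsto_joint]
  constructor
  · rintro ⟨O, hO, hs, hcont⟩
    exact eventually_nhds_iff.2 ⟨O, hO.continuousOn_iff.1 hcont, hO, hs⟩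
  · intro h
    obtain ⟨O, hcont, hO, hs⟩ := eventually_nhds_iff.1 h
    exact ⟨O, hO, hs, hO.continuousOn_iff.2 hcont⟩

variable (M) in
/-- All states of `M` satisfy the same atomic formulas of `LCD`. In terms of bisimulations, the
total relation on the states of `M` respects atoms. -/
structure AtomicallyUniform : Prop where
  atom : ∀ P xs s t, M.HoldsAtom s P xs → M.HoldsAtom t P xs
  exactDep : ∀ X Y s t, M.ExactDep s X Y → M.ExactDep t X Y
  epistemicDep : ∀ X Y s t, M.EpistemicDep s X Y → M.EpistemicDep t X Y

theorem AtomicallyUniform.sat (hM : M.AtomicallyUniform) (φ : LCD ar) (s t : M.State)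
    (hs : φ.Sat M s) : φ.Sat M t := by
  induction φ generalizing s t with
  | atom P xs => exact hM.atom P xs s t hs
  | neg φ ih => exact fun ht => hs (ih t s ht)
  | and φ ψ ihφ ihψ => exact ⟨ihφ s t hs.1, ihψ s t hs.2⟩
  | det X φ ih => exact fun r _ => ih s r (hs s rfl)
  | know X φ ih =>
    have hφs : φ.Sat M s := @interior_subset _ (M.stateTop X) _ _ hs
    exact knowable_iff_eventually.2 (.of_forall fun r => ih s r hφs)
  | exactDep X Y => exact hM.exactDep X Y s t hs
  | epistemicDep X Y => exact hM.epistemicDep X Y s t hs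

theorem ExactDep.of_empty (h : M.ExactDep s ∅ Y) (t : M.State) : M.ExactDep t ∅ Y := fun r _ =>
  (h t (joint_eq_iff.2 (by simp))).symm.trans (h r (joint_eq_iff.2 (by simp)))

theorem EpistemicDep.of_empty (h : M.EpistemicDep s ∅ Y) (t : M.State) :
    M.EpistemicDep t ∅ Y := by
  rw [epistemicDep_iff_eventually_condKnowable, stateNhds_empty] at h ⊢
  exact h

end TopoDepModel

section Expressivity

variable {Var : Type u} {Pred : Type v} {ar : Pred → ℕ}
  {C C' : Set (TopoDepModel.{u, v, w} (Var := Var) ar)} {ψ : LKk (Var := Var) ar}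

theorem ExpressibleInLCD.mono (hC : C ⊆ C') : ExpressibleInLCD C' ψ → ExpressibleInLCD C ψ :=
  Exists.imp fun _ hφ M hM => hφ M (hC hM)

theorem not_expressibleInLCD_of_atomicallyUniform {M : TopoDepModel.{u, v, w} (Var := Var) ar}
    (hM : M.AtomicallyUniform) (hC : M ∈ C) {s t : M.State} (hs : ψ.Sat M s) (ht : ¬ ψ.Sat M t) :
    ¬ ExpressibleInLCD C ψ := fun ⟨φ, hφ⟩ =>
  ht ((hφ M hC t).1 (hM.sat φ s t ((hφ M hC s).2 hs)))

/-- The translation of `LCD` into `LKk`, sending `K_X Y` to `K_X k_X Y`. -/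
def LCD.toLKk : LCD (Var := Var) ar → LKk (Var := Var) ar
  | .atom P xs => .atom P xs
  | .neg φ => .neg φ.toLKk
  | .and φ ψ => .and φ.toLKk ψ.toLKk
  | .det X φ => .det X φ.toLKk
  | .know X φ => .know X φ.toLKk
  | .exactDep X Y => .exactDep X Y
  | .epistemicDep X Y => .know X (.condKnow X Y)

theorem LCD.sat_toLKk (M : TopoDepModel.{u, v, w} (Var := Var) ar) (φ : LCD ar) (s : M.State) :
    φ.toLKk.Sat M s ↔ φ.Sat M s := by
  induction φ generalizing s with
  | atom P xs => rfl
  | neg φ ih => exact not_congr (ih s)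
  | and φ ψ ihφ ihψ => exact and_congr (ihφ s) (ihψ s)
  | det X φ ih => simp only [toLKk, LKk.Sat, Sat, ih]
  | know X φ ih => simp only [toLKk, LKk.Sat, Sat, ih]
  | exactDep X Y => rfl
  | epistemicDep X Y =>
    exact TopoDepModel.knowable_iff_eventually.trans
      TopoDepModel.epistemicDep_iff_eventually_condKnowable.symm

theorem lkkStrictlyMoreExpressive_of_not_expressibleInLCD (h : ¬ ExpressibleInLCD C ψ) :
    LKkStrictlyMoreExpressive C :=
  ⟨fun φ => ⟨φ.toLKk, fun M _ s => (φ.sat_toLKk M s).symm⟩, ψ, h⟩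

end Expressivity

section Permutations

variable {Var : Type u} {Pred : Type v} {T : Type w} [TopologicalSpace T] [T0Space T]

/-- The model whose states and values are the points of `T` and whose variables are the
permutations `p x` of `T`; all predicates are empty. -/
abbrev permModel (ar : Pred → ℕ) (p : Var → Equiv.Perm T) :
    TopoDepModel.{u, v, w} (Var := Var) ar where
  D _ := T
  top _ := inferInstance
  t0 _ := inferInstance
  I _ := ∅
  State := T
  val x := p x
  surj x := (p x).surjective

variable {ar : Pred → ℕ} {p : Var → Equiv.Perm T} {A B : Finset Var}

theorem permModel_exactDep_of_nonempty (hA : A.Nonempty) (s : T) :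
    (permModel ar p).ExactDep s A B := by
  obtain ⟨a, ha⟩ := hA
  intro t hst
  rw [(p a).injective (TopoDepModel.joint_eq_iff.1 hst a ha)]

theorem permModel_condKnowable_of_forall_exists_eq (h : ∀ b ∈ B, ∃ a ∈ A, p a = p b) (s : T) :
    (permModel ar p).CondKnowable s A B := by
  refine TopoDepModel.condKnowable_iff_forall_tendsto.2 fun b hb => ?_
  obtain ⟨a, ha, hab⟩ := h b hb
  change Tendsto (p b) _ (𝓝 (p b s))
  rw [← hab, tendsto_iff_comap, TopoDepModel.stateNhds_eq_iInf]
  exact iInf₂_le a ha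

theorem permModel_stateNhds_eq_map {q : Equiv.Perm T} (hA : A.Nonempty)
    (hq : ∀ a ∈ A, p a = q) (s : T) :
    (permModel ar p).stateNhds A s = map q.symm (𝓝 (q s)) := by
  rw [TopoDepModel.stateNhds_eq_iInf, ← comap_equiv_symm, q.symm_symm]
  exact (biInf_congr fun a ha => by simp only [hq a ha]).trans (biInf_const hA)

theorem permModel_condKnowable_iff {q : Equiv.Perm T} (hA : A.Nonempty)
    (hq : ∀ a ∈ A, p a = q) {s : T} :
    (permModel ar p).CondKnowable s A B ↔ ∀ b ∈ B, ContinuousAt (p b * q⁻¹) (q s) := by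
  rw [TopoDepModel.condKnowable_iff_forall_tendsto, permModel_stateNhds_eq_map hA hq]
  simp [ContinuousAt, tendsto_map'_iff, Function.comp_def]

theorem permModel_epistemicDep_iff {q : Equiv.Perm T} (hA : A.Nonempty)
    (hq : ∀ a ∈ A, p a = q) {s : T} :
    (permModel ar p).EpistemicDep s A B ↔
      ∀ᶠ t in 𝓝 (q s), ∀ b ∈ B, ContinuousAt (p b * q⁻¹) t := by
  simp only [TopoDepModel.epistemicDep_iff_eventually_condKnowable,
    permModel_condKnowable_iff hA hq, permModel_stateNhds_eq_map hA hq, eventually_map,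
    Equiv.apply_symm_apply]

theorem permModel_atomicallyUniform (htwo : ∀ x y z, p x = p y ∨ p y = p z ∨ p x = p z)
    (hdisc : ∀ x y, p x ≠ p y → ∀ s, ¬ ∀ᶠ t in 𝓝 s, ContinuousAt (p y * (p x)⁻¹) t) :
    (permModel ar p).AtomicallyUniform where
  atom _ _ _ _ h := h.elim
  exactDep A B s t h := by
    rcases A.eq_empty_or_nonempty with rfl | hA
    · exact h.of_empty t
    · exact permModel_exactDep_of_nonempty hA t
  epistemicDep A B s t h := by
    rcases A.eq_empty_or_nonempty with rfl | hA
    · exact h.of_empty t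
    by_cases hAB : ∀ b ∈ B, ∃ a ∈ A, p a = p b
    · exact TopoDepModel.epistemicDep_iff_eventually_condKnowable.2
        (.of_forall (permModel_condKnowable_of_forall_exists_eq hAB))
    · push Not at hAB
      obtain ⟨b, hb, hne⟩ := hAB
      have ⟨a, ha⟩ := hA
      have hconst : ∀ c ∈ A, p c = p a := fun c hc =>
        (htwo c a b).resolve_right (not_or.2 ⟨hne a ha, hne c hc⟩)
      have hcont := (permModel_epistemicDep_iff hA hconst).1 h
      exact absurd (hcont.mono fun r hr => hr b hb) (hdisc a b (hne a ha) _)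

end Permutations

section Reflection

open Classical in
/-- The permutation of the real line that reflects the irrationals at `0` and fixes the
rationals. The real line is lifted to the universe in which models take their states. -/
noncomputable def reflectIrrationals : Equiv.Perm (ULift.{w} ℝ) :=
  Function.Involutive.toPerm ({r | Irrational r.down}.piecewise Neg.neg id) fun r => by
    by_cases hr : Irrational r.down
    · simp [piecewise, hr]
    · simp [piecewise, hr]

theorem reflectIrrationals_inv : reflectIrrationals.{w}⁻¹ = reflectIrrationals :=
  Function.Involutive.toPerm_symm _

theorem continuousAt_reflectIrrationals_iff {r : ULift.{w} ℝ} :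
    ContinuousAt reflectIrrationals r ↔ r = 0 := by
  classical
  have hirr : Dense {r : ULift.{w} ℝ | Irrational r.down} :=
    dense_irrational.preimage Homeomorph.ulift.isOpenMap
  have hrat : Dense {r : ULift.{w} ℝ | Irrational r.down}ᶜ :=
    (Rat.isDenseEmbedding_coe_real.dense.preimage Homeomorph.ulift.isOpenMap).mono
      fun r hr hirr => hirr hr
  refine (continuousAt_piecewise_iff_of_dense hirr hrat continuousAt_neg continuousAt_id).trans ?_
  simp only [ULift.ext_iff, ULift.neg_down, id_eq, ULift.zero_down, neg_eq_self]

theorem not_eventually_continuousAt_reflectIrrationals (s : ULift.{w} ℝ) :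
    ¬ ∀ᶠ r in 𝓝 s, ContinuousAt reflectIrrationals r := fun h =>
  mem_closure_iff_frequently.1 (dense_compl_singleton (0 : ULift.{w} ℝ) s) <|
    h.mono fun _ hr hne => hne (continuousAt_reflectIrrationals_iff.1 hr)

end Reflection

section Inexpressibility

variable {Var : Type u} {Pred : Type v} (ar : Pred → ℕ) {X Y : Finset Var}

theorem not_expressibleInLCD_condKnow_metricModels (hX : X.Nonempty) (hY : ¬ Y ⊆ X) :
    ¬ ExpressibleInLCD (metricModels.{u, v, w} ar) (.condKnow X Y) := by
  classical
  let p : Var → Equiv.Perm (ULift.{w} ℝ) := fun x => if x ∈ X then 1 else reflectIrrationals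
  have hp : ∀ x, p x = 1 ∨ p x = reflectIrrationals := fun x => ite_eq_or_eq _ _ _
  have huniform : (permModel ar p).AtomicallyUniform := by
    refine permModel_atomicallyUniform (fun x y z => ?_) (fun x y hxy => ?_)
    · rcases hp x with hx | hx <;> rcases hp y with hy | hy <;> rcases hp z with hz | hz <;>
        simp [hx, hy, hz]
    · have hquot : p y * (p x)⁻¹ = reflectIrrationals := by
        rcases hp x with hx | hx <;> rcases hp y with hy | hy <;>
          simp_all [reflectIrrationals_inv]
      rw [hquot]
      exact not_eventually_continuousAt_reflectIrrationals
  have hknow (s : ULift.{w} ℝ) : (permModel ar p).CondKnowable s X Y ↔ s = 0 := by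
    have hone : ∀ x ∈ X, p x = 1 := fun x hx => if_pos hx
    obtain ⟨y, hyY, hyX⟩ := Finset.not_subset.1 hY
    have hy : p y = reflectIrrationals := if_neg hyX
    rw [permModel_condKnowable_iff hX hone, ← continuousAt_reflectIrrationals_iff]
    refine ⟨fun h => by simpa [hy] using h y hyY, fun h z _ => ?_⟩
    rcases hp z with hz | hz
    · simpa [hz] using continuousAt_id
    · simpa [hz] using h
  exact not_expressibleInLCD_of_atomicallyUniform huniform (s := (0 : ULift ℝ)) (t := (1 : ULift ℝ))
    (fun _ => inferInstanceAs (TopologicalSpace.MetrizableSpace (ULift ℝ)))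
    ((hknow 0).2 rfl) (fun h => one_ne_zero ((hknow 1).1 h))

theorem not_expressibleInLCD_empty_condKnow_topoModels (hY : Y.Nonempty) :
    ¬ ExpressibleInLCD (topoModels.{u, v, w} ar) (.condKnow ∅ Y) := by
  let p : Var → Equiv.Perm (ULift.{w} Prop) := 1
  have huniform : (permModel ar p).AtomicallyUniform :=
    permModel_atomicallyUniform (fun _ _ _ => .inl rfl) (fun _ _ h => absurd rfl h)
  have hknow (s : ULift.{w} Prop) : (permModel ar p).CondKnowable s ∅ Y ↔ 𝓝 s = ⊤ := by
    rw [TopoDepModel.condKnowable_iff_stateNhds_le, TopoDepModel.stateNhds_empty,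
      permModel_stateNhds_eq_map (p := p) (q := 1) hY (fun _ _ => rfl), top_le_iff]
    exact Iff.of_eq (congrArg (· = ⊤) map_id)
  have hfalse : 𝓝 (ULift.up.{w} False) = ⊤ := by
    rw [Homeomorph.ulift.nhds_eq_comap]
    exact (congrArg _ nhds_false).trans comap_top
  have htrue : 𝓝 (ULift.up.{w} True) ≠ ⊤ := by
    intro h
    have hopen : ULift.down ⁻¹' {True} ∈ 𝓝 (ULift.up.{w} True) :=
      (isOpen_singleton_true.preimage continuous_uliftDown).mem_nhds rfl
    rw [h, mem_top] at hopen
    have hmem : ULift.up.{w} False ∈ ULift.down ⁻¹' {True} := hopen ▸ mem_univ _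
    exact false_ne_true hmem
  exact not_expressibleInLCD_of_atomicallyUniform huniform (mem_univ _)
    (s := ULift.up False) (t := ULift.up True) ((hknow _).2 hfalse) (mt (hknow _).1 htrue)

theorem not_expressibleInLCD_condKnow_topoModels (hY : ¬ Y ⊆ X) :
    ¬ ExpressibleInLCD (topoModels.{u, v, w} ar) (.condKnow X Y) := by
  rcases X.eq_empty_or_nonempty with rfl | hX
  · exact not_expressibleInLCD_empty_condKnow_topoModels ar
      (Finset.nonempty_of_ne_empty fun h => hY h.subset)
  · exact mt (ExpressibleInLCD.mono (subset_univ _))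
      (not_expressibleInLCD_condKnow_metricModels ar hX hY)

end Inexpressibility

end DepLogic

theorem mainTheorem3 {Var : Type u} {Pred : Type v} (ar : Pred → ℕ) :
    (∀ X Y : Finset Var, ¬ Y ⊆ X →
      ¬ DepLogic.ExpressibleInLCD (DepLogic.topoModels.{u, v, w} ar) (.condKnow X Y)) ∧
    (∀ X Y : Finset Var, X.Nonempty → ¬ Y ⊆ X →
      ¬ DepLogic.ExpressibleInLCD (DepLogic.metricModels.{u, v, w} ar) (.condKnow X Y)) ∧
    (Nonempty Var →
      DepLogic.LKkStrictlyMoreExpressive (DepLogic.topoModels.{u, v, w} (Var := Var) ar)) ∧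
    (Nontrivial Var →
      DepLogic.LKkStrictlyMoreExpressive (DepLogic.metricModels.{u, v, w} (Var := Var) ar)) := by
  refine ⟨fun _ _ => DepLogic.not_expressibleInLCD_condKnow_topoModels ar,
    fun _ _ => DepLogic.not_expressibleInLCD_condKnow_metricModels ar, ?_, ?_⟩
  · rintro ⟨y⟩
    have hy : ¬ {y} ⊆ (∅ : Finset Var) := by simp
    exact DepLogic.lkkStrictlyMoreExpressive_of_not_expressibleInLCD
      (DepLogic.not_expressibleInLCD_condKnow_topoModels ar hy)
  · rintro ⟨x, y, hxy⟩
    have hyx : ¬ {y} ⊆ ({x} : Finset Var) := by simpa using hxy.symm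
    exact DepLogic.lkkStrictlyMoreExpressive_of_not_expressibleInLCD
      (DepLogic.not_expressibleInLCD_condKnow_metricModels ar (Finset.singleton_nonempty x) hyx)
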